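/- Fix $p$. For each $n$ consider the linear model $Y = X\beta^* + \varepsilon$, where $\beta^*\in\mathbb{R}^p$ is fixed, $X$ is an $n\times p$ design matrix (depending on $n$; deterministic or, more generally, random and independent of $\varepsilon$), and $\varepsilon=(\varepsilon_1,\dots,\varepsilon_n)'$ has i.i.d. $\mathcal N(0,\sigma^2)$ entries. Given $\lambda_n,\mu_n\ge 0$, let the S-Lasso estimator $\hat\beta^{SL}=\hat\beta^{SL}_n$ be a (measurable) minimizer over $\beta\in\mathbb{R}^p$ of $$\frac1n\sum_{i=1}^n\bigl(Y_i-(X\beta)_i\bigr)^2+\lambda_n\sum_{j=1}^p|\beta_j|+\mu_n\sum_{j=2}^p(\beta_j-\beta_{j-1})^2 .$$ Suppose that $\mathbf C_n=n^{-1}X'X\to\mathbf C$ in probability as $n\to\infty$, where $\mathbf C$ is a positive definite matrix. Let $(v_n)$ be a sequence of nonzero reals with $v_n\to0$, $\lambda_n/v_n\to\lambda\ge0$, $\mu_n/v_n\to\mu\ge0$ and $1/(\sqrt n\,v_n)\to\kappa\ge0$ (finite limits). Let $W\sim\mathcal N(0,\sigma^2\mathbf C)$ and $$V(u)=-2\kappa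 u'W+u'\mathbf Cu+\lambda\sum_{j=1}^p\bigl\{u_j\,\mathrm{Sgn}(\beta_j^*)\mathbb I(\beta_j^*\ne0)+|u_j|\,\mathbb I(\beta_j^*=0)\bigr\}+2\mu\sum_{j=2}^p(u_j-u_{j-1})(\beta_j^*-\beta_{j-1}^*)\mathbb I(\beta_j^*\ne\beta_{j-1}^*),$$ where $\mathrm{Sgn}(x)$ is $1$, $-1$ or $0$ according as $x>0$, $x<0$ or $x=0$. Then $V$ is convex and has a unique minimizer (for every value of $W$), and, as $n\to\infty$, $$v_n^{-1}(\hat\beta^{SL}-\beta^*)\xrightarrow{\ \mathcal D\ }\operatorname*{arg\,min}_{u\in\mathbb{R}^p}V(u).$$ -/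

import Mathlib

open MeasureTheory ProbabilityTheory Filter Topology
open scoped Matrix

namespace SLasso

/-- For `k = 0, …, p - 2`, the first index of the `k`-th pair of successive indices in `Fin p`. -/
def prev {p : ℕ} (k : Fin (p - 1)) : Fin p := ⟨k.1, by omega⟩

/-- For `k = 0, …, p - 2`, the second index of the `k`-th pair of successive indices in `Fin p`. -/
def succ {p : ℕ} (k : Fin (p - 1)) : Fin p := ⟨k.1 + 1, by omega⟩

/-- The S-Lasso penalty `lam * |b|₁ + mu * ∑_{j = 2}^p (b_j - b_{j-1})²`. -/
noncomputable def penalty {p : ℕ} (lam mu : ℝ) (b : EuclideanSpace ℝ (Fin p)) : ℝ :=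
  lam * ∑ j, |b j| + mu * ∑ k : Fin (p - 1), (b (succ k) - b (prev k)) ^ 2

/-- The S-Lasso criterion `‖y - X b‖_n² + penalty(b)`, where `‖a‖_n² = n⁻¹ ∑ a_i²`. -/
noncomputable def criterion {n p : ℕ} (X : Matrix (Fin n) (Fin p) ℝ) (y : Fin n → ℝ)
    (lam mu : ℝ) (b : EuclideanSpace ℝ (Fin p)) : ℝ :=
  (n : ℝ)⁻¹ * ∑ i, (y i - (X *ᵥ b.ofLp) i) ^ 2 + penalty lam mu b

/-- `b` solves the S-Lasso optimization problem with data `(X, y)`. -/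
def IsSLasso {n p : ℕ} (X : Matrix (Fin n) (Fin p) ℝ) (y : Fin n → ℝ)
    (lam mu : ℝ) (b : EuclideanSpace ℝ (Fin p)) : Prop :=
  IsMinOn (criterion X y lam mu) Set.univ b

/-- The normalized Gram matrix `C_n = n⁻¹ X'X`. -/
noncomputable def gram {n p : ℕ} (X : Matrix (Fin n) (Fin p) ℝ) : Matrix (Fin p) (Fin p) ℝ :=
  (n : ℝ)⁻¹ • (Xᵀ * X)

/-- The limiting objective `V(u)`, for the value `w` of the Gaussian vector `W`. -/
noncomputable def limitObjective {p : ℕ} (C : Matrix (Fin p) (Fin p) ℝ)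
    (β : EuclideanSpace ℝ (Fin p)) (lam mu κ : ℝ) (w u : EuclideanSpace ℝ (Fin p)) : ℝ :=
  -2 * κ * (u.ofLp ⬝ᵥ w.ofLp) + u.ofLp ⬝ᵥ (C *ᵥ u.ofLp)
    + lam * ∑ j, (u j * Real.sign (β j) * (if β j ≠ 0 then 1 else 0)
        + |u j| * (if β j = 0 then 1 else 0))
    + 2 * mu * ∑ k : Fin (p - 1), (u (succ k) - u (prev k)) * (β (succ k) - β (prev k))
        * (if β (succ k) ≠ β (prev k) then 1 else 0)

end SLasso

/-!
The rescaled estimator `u_n = v_n⁻¹ (β̂ - β)` minimizes the localized criterion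
`u ↦ v_n⁻² (criterion (β + v_n u) - criterion β)`, which equals
`-2 (√n v_n)⁻¹ u'S_n + u'C_n u + (rescaled penalty)`, where `S_n = n^{-1/2} X'ε` is the score. This
is the limiting objective with `W` replaced by `S_n`, up to an error of at most `Δ_n (1 + ‖u‖²)`
(`SLasso.abs_localCriterion_sub_limitObjective_le`). Here `Δ_n → 0` in probability, because `S_n` is
bounded in probability, `C_n → C` in probability, and the rescaled penalty converges with an error
that is `o(1 + ‖u‖²)` uniformly in `u`.

The limiting objective is strongly convex, since `C` is positive definite and `λ ≥ 0`. Hence it has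
a unique minimizer `g w` for every value `w` of `W`, the map `g` is Lipschitz
(`SLasso.dist_isMinOn_limitObjective_le`), and a perturbation of relative size `Δ` moves the
minimizer by `O(√Δ)` (`StrongConvexOn.sq_dist_isMinOn_le`). The bound on the perturbation is global,
so that no separate argument for the tightness of `u_n` is needed, and `u_n - g S_n → 0` in
probability (`SLasso.tendstoInMeasure_estimator_sub`).

It remains to see that `S_n → W` in distribution. Given the design, `S_n` is Gaussian with covariance
`σ² C_n`, so its characteristic function at `t` is the expectation of `exp (-σ² t'C_n t / 2)`, which
converges by bounded convergence (`SLasso.tendsto_charFun_map_score`). Lévy's theorem gives the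
convergence in distribution as well as the tightness of the scores. The continuous mapping theorem
and Slutsky's lemma then yield `u_n → g W`, and `g W` is almost surely the given minimizer.
-/

/-! ### Minimizers of strongly convex functions -/

section StrongConvex

variable {E : Type*} [NormedAddCommGroup E] [NormedSpace ℝ E] {f h : E → ℝ} {m Δ : ℝ} {g u : E}

/-- Quadratic growth of a strongly convex function away from its minimizer. -/
lemma StrongConvexOn.add_sq_dist_le_of_isMinOn (hf : StrongConvexOn Set.univ m f)
    (hg : IsMinOn f Set.univ g) (u : E) : f g + m / 2 * ‖u - g‖ ^ 2 ≤ f u := by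
  have key : ∀ t ∈ Set.Ioo (0 : ℝ) 1, f g + (1 - t) * (m / 2 * ‖u - g‖ ^ 2) ≤ f u := by
    intro t ht
    have h1 := hf.2 (Set.mem_univ u) (Set.mem_univ g) ht.1.le (sub_nonneg.2 ht.2.le)
      (add_sub_cancel t 1)
    have h2 : f g ≤ f (t • u + (1 - t) • g) := hg (Set.mem_univ _)
    simp only [smul_eq_mul] at h1
    refine le_of_mul_le_mul_left ?_ ht.1
    linarith
  have hlim : Tendsto (fun t : ℝ => f g + (1 - t) * (m / 2 * ‖u - g‖ ^ 2)) (𝓝[>] 0)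
      (𝓝 (f g + m / 2 * ‖u - g‖ ^ 2)) := by
    have hc : Continuous fun t : ℝ => f g + (1 - t) * (m / 2 * ‖u - g‖ ^ 2) := by fun_prop
    simpa using (hc.tendsto 0).mono_left nhdsWithin_le_nhds
  refine le_of_tendsto hlim ?_
  filter_upwards [Ioo_mem_nhdsGT one_pos] with t ht using key t ht

lemma StrongConvexOn.eq_of_isMinOn (hf : StrongConvexOn Set.univ m f) (hm : 0 < m)
    (hg : IsMinOn f Set.univ g) (hu : IsMinOn f Set.univ u) : u = g := by
  have h1 := hf.add_sq_dist_le_of_isMinOn hg u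
  have h2 : f u ≤ f g := hu (Set.mem_univ g)
  have h3 : ‖u - g‖ ^ 2 ≤ 0 := by nlinarith
  have h4 : ‖u - g‖ = 0 := by nlinarith [norm_nonneg (u - g)]
  exact sub_eq_zero.1 (norm_eq_zero.1 h4)

lemma StrongConvexOn.exists_isMinOn [FiniteDimensional ℝ E] (hf : StrongConvexOn Set.univ m f)
    (hm : 0 < m) (hc : Continuous f) : ∃ g, IsMinOn f Set.univ g := by
  have : ProperSpace E := FiniteDimensional.proper ℝ E
  obtain ⟨x₀, -, hx₀⟩ := (isCompact_closedBall (0 : E) 1).exists_isMinOn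
    ⟨0, by simp⟩ hc.continuousOn
  have hB : f x₀ ≤ f 0 := hx₀ (by simp)
  obtain ⟨g, hg⟩ := hc.exists_forall_le' 0 (by
    filter_upwards [(tendsto_norm_cocompact_atTop (E := E)).eventually_ge_atTop
      (1 + 2 * (f 0 - f x₀) / m)] with u hu
    have hu1 : 1 ≤ ‖u‖ := le_trans (by
      have : 0 ≤ 2 * (f 0 - f x₀) / m := div_nonneg (by linarith) hm.le
      linarith) hu
    have hu0 : 0 < ‖u‖ := by linarith
    have hinv : ‖u‖⁻¹ ≤ 1 := inv_le_one_of_one_le₀ hu1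
    -- compare `f u` and `f 0` through the point of the segment `[0, u]` on the unit sphere
    have h1 := hf.2 (Set.mem_univ u) (Set.mem_univ 0) (inv_nonneg.2 hu0.le)
      (sub_nonneg.2 hinv) (add_sub_cancel _ 1)
    have h2 : f x₀ ≤ f (‖u‖⁻¹ • u + (1 - ‖u‖⁻¹) • (0 : E)) := hx₀ (by
      simp [norm_smul, hu0.ne'])
    simp only [smul_eq_mul, sub_zero] at h1
    have h3 : f x₀ * ‖u‖ ≤ f u + (‖u‖ - 1) * f 0 - (‖u‖ - 1) * (m / 2 * ‖u‖) := by
      have := mul_le_mul_of_nonneg_right (h2.trans h1) hu0.le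
      field_simp at this ⊢
      linarith
    have h4 : f 0 - f x₀ ≤ (‖u‖ - 1) * (m / 2) := by
      have : 2 * (f 0 - f x₀) / m ≤ ‖u‖ - 1 := by linarith
      rw [div_le_iff₀ hm] at this
      linarith
    nlinarith [mul_le_mul_of_nonneg_right h4 hu0.le])
  exact ⟨g, fun y _ => hg y⟩

/-- Stability of the minimizer of a strongly convex function under a perturbation that is small
relative to `1 + ‖x‖ ^ 2`. The perturbed function `h` need not be convex. -/
lemma StrongConvexOn.sq_dist_isMinOn_le (hf : StrongConvexOn Set.univ m f)
    (hg : IsMinOn f Set.univ g) (hu : IsMinOn h Set.univ u)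
    (hfh : ∀ x, |h x - f x| ≤ Δ * (1 + ‖x‖ ^ 2)) (hΔ : Δ ≤ m / 8) :
    m / 4 * ‖u - g‖ ^ 2 ≤ Δ * (2 + 3 * ‖g‖ ^ 2) := by
  have h1 := hf.add_sq_dist_le_of_isMinOn hg u
  have h2 : h u ≤ h g := hu (Set.mem_univ g)
  have h3 := (abs_le.1 (hfh u)).1
  have h4 := (abs_le.1 (hfh g)).2
  have hΔ0 : 0 ≤ Δ := by
    have := (abs_nonneg _).trans (hfh 0)
    simpa using this
  have h5 : ‖u‖ ≤ ‖u - g‖ + ‖g‖ := by simpa using norm_add_le (u - g) g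
  have h6 : ‖u‖ ^ 2 ≤ 2 * ‖u - g‖ ^ 2 + 2 * ‖g‖ ^ 2 := by
    nlinarith [norm_nonneg u, norm_nonneg (u - g), norm_nonneg g, sq_nonneg (‖u - g‖ - ‖g‖)]
  have h7 := mul_le_mul_of_nonneg_left h6 hΔ0
  have h8 := mul_le_mul_of_nonneg_right hΔ (sq_nonneg ‖u - g‖)
  linarith

end StrongConvex

/-! ### The limiting objective -/

namespace SLasso

variable {p : ℕ}

/-- The nonrandom part of the limiting objective that comes from the penalty: the limit of
`v⁻² (penalty (β + v u) - penalty β)` as `v → 0` with tuning parameters divided by `v` tending to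
`lam` and `mu`. -/
noncomputable def limitPenalty (β : EuclideanSpace ℝ (Fin p)) (lam mu : ℝ)
    (u : EuclideanSpace ℝ (Fin p)) : ℝ :=
  lam * ∑ j, (u j * Real.sign (β j) * (if β j ≠ 0 then 1 else 0)
      + |u j| * (if β j = 0 then 1 else 0))
    + 2 * mu * ∑ k : Fin (p - 1), (u (succ k) - u (prev k)) * (β (succ k) - β (prev k))
      * (if β (succ k) ≠ β (prev k) then 1 else 0)

lemma limitObjective_eq (C : Matrix (Fin p) (Fin p) ℝ) (β : EuclideanSpace ℝ (Fin p))
    (lam mu κ : ℝ) (w u : EuclideanSpace ℝ (Fin p)) :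
    limitObjective C β lam mu κ w u = -2 * κ * (u.ofLp ⬝ᵥ w.ofLp) + u.ofLp ⬝ᵥ (C *ᵥ u.ofLp)
      + limitPenalty β lam mu u := by
  simp only [limitObjective, limitPenalty]; ring

lemma limitPenalty_combo_le (β : EuclideanSpace ℝ (Fin p)) {lam : ℝ} (mu : ℝ) (hlam : 0 ≤ lam)
    (x y : EuclideanSpace ℝ (Fin p)) {a b : ℝ} (ha : 0 ≤ a) (hb : 0 ≤ b) :
    limitPenalty β lam mu (a • x + b • y)
      ≤ a * limitPenalty β lam mu x + b * limitPenalty β lam mu y := by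
  have e : a * limitPenalty β lam mu x + b * limitPenalty β lam mu y
      = lam * ∑ j, (a * (x j * Real.sign (β j) * (if β j ≠ 0 then 1 else 0)
            + |x j| * (if β j = 0 then 1 else 0))
          + b * (y j * Real.sign (β j) * (if β j ≠ 0 then 1 else 0)
            + |y j| * (if β j = 0 then 1 else 0)))
        + 2 * mu * ∑ k : Fin (p - 1),
          ((a • x + b • y) (succ k) - (a • x + b • y) (prev k)) * (β (succ k) - β (prev k))
          * (if β (succ k) ≠ β (prev k) then 1 else 0) := by
    have e2 : ∀ k : Fin (p - 1),
        ((a • x + b • y) (succ k) - (a • x + b • y) (prev k)) * (β (succ k) - β (prev k))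
          * (if β (succ k) ≠ β (prev k) then 1 else 0)
        = a * ((x (succ k) - x (prev k)) * (β (succ k) - β (prev k))
            * (if β (succ k) ≠ β (prev k) then 1 else 0))
          + b * ((y (succ k) - y (prev k)) * (β (succ k) - β (prev k))
            * (if β (succ k) ≠ β (prev k) then 1 else 0)) := by
      intro k
      simp only [PiLp.add_apply, PiLp.smul_apply, smul_eq_mul]
      ring
    simp only [e2, Finset.sum_add_distrib, ← Finset.mul_sum, limitPenalty]
    ring
  rw [e, limitPenalty]
  refine add_le_add (mul_le_mul_of_nonneg_left (Finset.sum_le_sum fun j _ => ?_) hlam) le_rfl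
  have habs : |a * x j + b * y j| ≤ a * |x j| + b * |y j| :=
    (abs_add_le _ _).trans (by rw [abs_mul, abs_mul, abs_of_nonneg ha, abs_of_nonneg hb])
  simp only [PiLp.add_apply, PiLp.smul_apply, smul_eq_mul]
  split_ifs with h1 h2 <;> first | contradiction | (simp; linarith)

lemma dotProduct_mulVec_combo (C : Matrix (Fin p) (Fin p) ℝ) (x y : Fin p → ℝ) {a b : ℝ}
    (hab : a + b = 1) : (a • x + b • y) ⬝ᵥ (C *ᵥ (a • x + b • y))
      = a * (x ⬝ᵥ (C *ᵥ x)) + b * (y ⬝ᵥ (C *ᵥ y)) - a * b * ((x - y) ⬝ᵥ (C *ᵥ (x - y))) := by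
  obtain rfl := eq_sub_of_add_eq' hab
  simp only [Matrix.mulVec_add, Matrix.mulVec_sub, Matrix.mulVec_smul, add_dotProduct,
    dotProduct_add, sub_dotProduct, dotProduct_sub, smul_dotProduct, dotProduct_smul, smul_eq_mul]
  ring

lemma continuous_limitObjective (C : Matrix (Fin p) (Fin p) ℝ) (β : EuclideanSpace ℝ (Fin p))
    (lam mu κ : ℝ) (w : EuclideanSpace ℝ (Fin p)) :
    Continuous (limitObjective C β lam mu κ w) := by
  unfold limitObjective
  have h1 : Continuous fun u : EuclideanSpace ℝ (Fin p) => u.ofLp ⬝ᵥ w.ofLp := by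
    unfold dotProduct; fun_prop
  have h2 : Continuous fun u : EuclideanSpace ℝ (Fin p) => u.ofLp ⬝ᵥ (C *ᵥ u.ofLp) := by
    unfold Matrix.mulVec dotProduct; fun_prop
  fun_prop

lemma exists_pos_mul_sq_norm_le {C : Matrix (Fin p) (Fin p) ℝ} (hC : C.PosDef) :
    ∃ c > 0, ∀ u : EuclideanSpace ℝ (Fin p), c * ‖u‖ ^ 2 ≤ u.ofLp ⬝ᵥ (C *ᵥ u.ofLp) := by
  have hcont : Continuous fun u : EuclideanSpace ℝ (Fin p) => u.ofLp ⬝ᵥ (C *ᵥ u.ofLp) := by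
    unfold Matrix.mulVec dotProduct; fun_prop
  obtain ⟨c, hc, hcu⟩ := (isCompact_sphere (0 : EuclideanSpace ℝ (Fin p)) 1).exists_forall_le'
    hcont.continuousOn (a := 0) (fun u hu => by
      have hu0 : u.ofLp ≠ 0 := by
        intro h0
        have : u = 0 := by ext i; simp [h0]
        simp [this] at hu
      simpa using hC.dotProduct_mulVec_pos hu0)
  refine ⟨c, hc, fun u => ?_⟩
  by_cases hu : u = 0
  · simp [hu]
  have hn : 0 < ‖u‖ := norm_pos_iff.2 hu
  have h1 := hcu (‖u‖⁻¹ • u) (by simp [norm_smul, hn.ne'])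
  simp only [WithLp.ofLp_smul, Matrix.mulVec_smul, smul_dotProduct, dotProduct_smul,
    smul_eq_mul] at h1
  rw [← mul_assoc, ← sq, inv_pow, inv_mul_eq_div, le_div_iff₀ (by positivity)] at h1
  exact h1

lemma strongConvexOn_limitObjective {C : Matrix (Fin p) (Fin p) ℝ} {c : ℝ}
    (hC : ∀ u : EuclideanSpace ℝ (Fin p), c * ‖u‖ ^ 2 ≤ u.ofLp ⬝ᵥ (C *ᵥ u.ofLp))
    (β : EuclideanSpace ℝ (Fin p)) {lam : ℝ} (mu κ : ℝ) (hlam : 0 ≤ lam)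
    (w : EuclideanSpace ℝ (Fin p)) :
    StrongConvexOn Set.univ (2 * c) (limitObjective C β lam mu κ w) := by
  refine ⟨convex_univ, fun x _ y _ a b ha hb hab => ?_⟩
  have h1 := limitPenalty_combo_le β mu hlam x y ha hb
  have h2 := dotProduct_mulVec_combo C x.ofLp y.ofLp hab
  have h3 := mul_le_mul_of_nonneg_left (hC (x - y)) (mul_nonneg ha hb)
  simp only [limitObjective_eq, WithLp.ofLp_add, WithLp.ofLp_smul, WithLp.ofLp_sub, h2, smul_eq_mul,
    add_dotProduct, smul_dotProduct] at h3 ⊢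
  linarith

/-- The minimizer of the limiting objective is a Lipschitz function of the Gaussian vector. -/
lemma dist_isMinOn_limitObjective_le {C : Matrix (Fin p) (Fin p) ℝ} {c : ℝ}
    (hC : ∀ u : EuclideanSpace ℝ (Fin p), c * ‖u‖ ^ 2 ≤ u.ofLp ⬝ᵥ (C *ᵥ u.ofLp)) (hc : 0 < c)
    {β : EuclideanSpace ℝ (Fin p)} {lam mu κ : ℝ} (hlam : 0 ≤ lam) (hκ : 0 ≤ κ)
    {w w' g g' : EuclideanSpace ℝ (Fin p)}
    (hg : IsMinOn (limitObjective C β lam mu κ w) Set.univ g)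
    (hg' : IsMinOn (limitObjective C β lam mu κ w') Set.univ g') :
    ‖g - g'‖ ≤ κ / c * ‖w - w'‖ := by
  have h1 := (strongConvexOn_limitObjective hC β mu κ hlam w).add_sq_dist_le_of_isMinOn hg g'
  have h2 := (strongConvexOn_limitObjective hC β mu κ hlam w').add_sq_dist_le_of_isMinOn hg' g
  have h3 : (g - g').ofLp ⬝ᵥ (w - w').ofLp ≤ ‖g - g'‖ * ‖w - w'‖ := by
    have := real_inner_le_norm (w - w') (g - g')
    rw [EuclideanSpace.inner_eq_star_dotProduct] at this
    simpa [mul_comm] using this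
  rw [norm_sub_rev g' g] at h1
  simp only [limitObjective_eq, WithLp.ofLp_sub, sub_dotProduct, dotProduct_sub] at h1 h2 h3
  have h4 : c * ‖g - g'‖ ^ 2 ≤ κ * (‖g - g'‖ * ‖w - w'‖) := by
    have := mul_le_mul_of_nonneg_left h3 hκ
    linarith
  rcases (norm_nonneg (g - g')).eq_or_lt with h0 | h0
  · rw [← h0]; positivity
  rw [div_mul_eq_mul_div, le_div_iff₀ hc]
  refine le_of_mul_le_mul_left ?_ h0
  linarith

end SLasso

/-! ### The localized criterion -/

namespace SLasso

variable {n p : ℕ}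

/-- The normalized score vector `n^{-1/2} X' e`, where `e` is the noise. -/
noncomputable def score (X : Matrix (Fin n) (Fin p) ℝ) (e : Fin n → ℝ) :
    EuclideanSpace ℝ (Fin p) :=
  WithLp.toLp 2 ((Real.sqrt n)⁻¹ • (e ᵥ* X))

lemma dotProduct_score (X : Matrix (Fin n) (Fin p) ℝ) (e : Fin n → ℝ) (u : Fin p → ℝ) :
    u ⬝ᵥ (score X e).ofLp = (Real.sqrt n)⁻¹ * ∑ i, e i * (X *ᵥ u) i := by
  rw [score, dotProduct_smul, dotProduct_comm, ← Matrix.dotProduct_mulVec, smul_eq_mul]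
  rfl

lemma dotProduct_gram (X : Matrix (Fin n) (Fin p) ℝ) (u : Fin p → ℝ) :
    u ⬝ᵥ (gram X *ᵥ u) = (n : ℝ)⁻¹ * ∑ i, (X *ᵥ u) i ^ 2 := by
  rw [gram, Matrix.smul_mulVec, dotProduct_smul, ← Matrix.mulVec_mulVec,
    Matrix.dotProduct_mulVec, Matrix.vecMul_transpose, smul_eq_mul]
  simp only [dotProduct, sq]

/-- The rescaled criterion `v⁻² (criterion (β + v u) - criterion β)`. -/
noncomputable def localCriterion (X : Matrix (Fin n) (Fin p) ℝ) (y : Fin n → ℝ) (lam mu : ℝ)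
    (β : EuclideanSpace ℝ (Fin p)) (v : ℝ) (u : EuclideanSpace ℝ (Fin p)) : ℝ :=
  (v ^ 2)⁻¹ * (criterion X y lam mu (β + v • u) - criterion X y lam mu β)

/-- The rescaled penalty `v⁻² (penalty (β + v u) - penalty β)`. -/
noncomputable def localPenalty (lam mu : ℝ) (β : EuclideanSpace ℝ (Fin p)) (v : ℝ)
    (u : EuclideanSpace ℝ (Fin p)) : ℝ :=
  (v ^ 2)⁻¹ * (penalty lam mu (β + v • u) - penalty lam mu β)

lemma isMinOn_localCriterion {X : Matrix (Fin n) (Fin p) ℝ} {y : Fin n → ℝ} {lam mu v : ℝ}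
    {b : EuclideanSpace ℝ (Fin p)} (hb : IsSLasso X y lam mu b) (β : EuclideanSpace ℝ (Fin p))
    (hv : v ≠ 0) :
    IsMinOn (localCriterion X y lam mu β v) Set.univ (v⁻¹ • (b - β)) := by
  intro u _
  have h : criterion X y lam mu b ≤ criterion X y lam mu (β + v • u) := hb (Set.mem_univ _)
  have e : β + v • v⁻¹ • (b - β) = b := by rw [smul_inv_smul₀ hv]; abel
  simp only [Set.mem_ofPred_eq, localCriterion, e]
  gcongr

lemma localCriterion_eq {X : Matrix (Fin n) (Fin p) ℝ} {y e : Fin n → ℝ} {lam mu v : ℝ}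
    {β : EuclideanSpace ℝ (Fin p)} (hn : 0 < n) (hv : v ≠ 0)
    (hy : ∀ i, y i = (X *ᵥ β.ofLp) i + e i) (u : EuclideanSpace ℝ (Fin p)) :
    localCriterion X y lam mu β v u
      = -2 * (Real.sqrt n * v)⁻¹ * (u.ofLp ⬝ᵥ (score X e).ofLp) + u.ofLp ⬝ᵥ (gram X *ᵥ u.ofLp)
        + localPenalty lam mu β v u := by
  have hs : 0 < Real.sqrt n := Real.sqrt_pos.2 (Nat.cast_pos.2 hn)
  have hsn : (n : ℝ)⁻¹ = (Real.sqrt n)⁻¹ * (Real.sqrt n)⁻¹ := by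
    rw [← mul_inv, Real.mul_self_sqrt n.cast_nonneg]
  have h1 : ∀ i, (y i - (X *ᵥ (β + v • u).ofLp) i) ^ 2 - (y i - (X *ᵥ β.ofLp) i) ^ 2
      = v ^ 2 * (X *ᵥ u.ofLp) i ^ 2 - 2 * v * (e i * (X *ᵥ u.ofLp) i) := by
    intro i
    simp only [hy i, WithLp.ofLp_add, WithLp.ofLp_smul, Matrix.mulVec_add, Matrix.mulVec_smul,
      Pi.add_apply, Pi.smul_apply, smul_eq_mul]
    ring
  have h2 : criterion X y lam mu (β + v • u) - criterion X y lam mu β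
      = (n : ℝ)⁻¹ * (v ^ 2 * ∑ i, (X *ᵥ u.ofLp) i ^ 2 - 2 * v * ∑ i, e i * (X *ᵥ u.ofLp) i)
        + (penalty lam mu (β + v • u) - penalty lam mu β) := by
    rw [Finset.mul_sum, Finset.mul_sum, ← Finset.sum_sub_distrib, ← Finset.sum_congr rfl
      fun i _ => h1 i, Finset.sum_sub_distrib, criterion, criterion]
    ring
  rw [localCriterion, h2, localPenalty, dotProduct_score, dotProduct_gram, hsn, mul_inv]
  field_simp
  ring

/-- First-order expansion of `|b + x|` at `b`. At `b = 0` the junk value `1 / 0 = 0` on the right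
matches the exact identity there. -/
lemma abs_abs_add_sub_le (b x : ℝ) :
    |(|b + x| - |b|) - (x * Real.sign b * (if b ≠ 0 then 1 else 0)
      + |x| * (if b = 0 then 1 else 0))| ≤ 2 * x ^ 2 / |b| := by
  rcases lt_trichotomy b 0 with hb | rfl | hb
  · rw [Real.sign_of_neg hb, abs_of_neg hb, le_div_iff₀ (by linarith)]
    simp only [hb.ne, ne_eq, not_false_eq_true, if_true, if_false, mul_one, mul_zero, add_zero]
    rcases le_or_gt (b + x) 0 with h | h
    · rw [abs_of_nonpos h]
      have : -(b + x) - -b - x * -1 = 0 := by ring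
      rw [this]; simp; positivity
    · rw [abs_of_pos h, show b + x - -b - x * -1 = 2 * (b + x) by ring, abs_of_pos (by linarith)]
      nlinarith
  · simp
  · rw [Real.sign_of_pos hb, abs_of_pos hb, le_div_iff₀ hb]
    simp only [hb.ne', ne_eq, not_false_eq_true, if_true, if_false, mul_one, mul_zero, add_zero]
    rcases le_or_gt 0 (b + x) with h | h
    · rw [abs_of_nonneg h]
      have : b + x - b - x = 0 := by ring
      rw [this]; simp; positivity
    · rw [abs_of_neg h, show -(b + x) - b - x = 2 * (-(b + x)) by ring, abs_of_pos (by linarith)]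
      nlinarith

/-- Contribution of one coordinate to the error of the rescaled `ℓ¹` penalty; the scale `v` may have
either sign. -/
lemma abs_localPenalty_l1_term_le {l v lam b x N : ℝ} (hl : 0 ≤ l) (hlam : 0 ≤ lam) (hv : v ≠ 0)
    (hx : |x| ≤ N) :
    |(v ^ 2)⁻¹ * (l * (|b + v * x| - |b|)) - lam * (x * Real.sign b * (if b ≠ 0 then 1 else 0)
      + |x| * (if b = 0 then 1 else 0))|
      ≤ (|l / v - lam| + |l / v| * (2 * |v| / |b|)) * (1 + N ^ 2) := by
  set D := x * Real.sign b * (if b ≠ 0 then 1 else 0) + |x| * (if b = 0 then 1 else 0) with hD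
  set D' := v * x * Real.sign b * (if b ≠ 0 then 1 else 0) + |v * x| * (if b = 0 then 1 else 0)
    with hD'
  have hN : 0 ≤ N := (abs_nonneg x).trans hx
  have hx2 : x ^ 2 ≤ N ^ 2 := by rw [← sq_abs]; gcongr
  have hv2 : (v ^ 2)⁻¹ = |v|⁻¹ * |v|⁻¹ := by rw [← mul_inv, ← sq, sq_abs]
  have hv0 : 0 < |v| := abs_pos.2 hv
  have h1 : |(v ^ 2)⁻¹ * (l * ((|b + v * x| - |b|) - D'))| ≤ |l / v| * (2 * |v| / |b|) * N ^ 2 := by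
    rw [abs_mul, abs_mul, abs_of_nonneg hl, abs_div, abs_of_nonneg hl, abs_of_pos (by positivity)]
    calc (v ^ 2)⁻¹ * (l * |(|b + v * x| - |b|) - D'|)
        ≤ (v ^ 2)⁻¹ * (l * (2 * (v * x) ^ 2 / |b|)) := by
          gcongr; exact abs_abs_add_sub_le b (v * x)
      _ = l / |v| * (2 * |v| / |b|) * x ^ 2 := by
          rw [mul_pow, hv2, ← sq_abs v]; field_simp
      _ ≤ _ := by gcongr
  have h2 : |(v ^ 2)⁻¹ * (l * D') - lam * D| ≤ |l / v - lam| * N := by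
    by_cases hb : b = 0
    · -- here the sign of `v` is lost, which is harmless because `l` and `lam` are nonnegative
      have e : (v ^ 2)⁻¹ * (l * D') - lam * D = (|l / v| - |lam|) * |x| := by
        simp only [hD, hD', hb, abs_mul, abs_div, abs_of_nonneg hl, abs_of_nonneg hlam, hv2]
        simp
        field_simp
      rw [e, abs_mul, abs_abs]
      exact mul_le_mul (abs_abs_sub_abs_le _ _) hx (abs_nonneg _) (abs_nonneg _)
    · have e : (v ^ 2)⁻¹ * (l * D') - lam * D = (l / v - lam) * (x * Real.sign b) := by
        simp only [hD, hD', ne_eq, hb, not_false_eq_true, if_true, if_false]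
        field_simp
        ring
      have hs : |Real.sign b| ≤ 1 := by
        rcases Real.sign_apply_eq b with h | h | h <;> simp [h]
      rw [e, abs_mul, abs_mul]
      gcongr
      nlinarith [abs_nonneg x, abs_nonneg b.sign]
  have h3 : N ≤ 1 + N ^ 2 := by nlinarith [sq_nonneg (N - 1)]
  have h4 : N ^ 2 ≤ 1 + N ^ 2 := by linarith
  calc _ = |(v ^ 2)⁻¹ * (l * ((|b + v * x| - |b|) - D')) + ((v ^ 2)⁻¹ * (l * D') - lam * D)| := by
        congr 1; ring
    _ ≤ |l / v| * (2 * |v| / |b|) * N ^ 2 + |l / v - lam| * N :=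
        (abs_add_le _ _).trans (add_le_add h1 h2)
    _ ≤ |l / v| * (2 * |v| / |b|) * (1 + N ^ 2) + |l / v - lam| * (1 + N ^ 2) := by gcongr
    _ = _ := by ring

lemma abs_localPenalty_l2_term_le {l v mu d x N : ℝ} (hv : v ≠ 0) (hx : |x| ≤ 2 * N) :
    |(v ^ 2)⁻¹ * (l * ((d + v * x) ^ 2 - d ^ 2)) - 2 * mu * (x * d)|
      ≤ (4 * |l / v - mu| * |d| + 4 * |l / v| * |v|) * (1 + N ^ 2) := by
  have hN : 0 ≤ N := by linarith [abs_nonneg x]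
  have h3 : N ≤ 1 + N ^ 2 := by nlinarith [sq_nonneg (N - 1)]
  have hx2 : x ^ 2 ≤ 4 * (1 + N ^ 2) := by
    have : x ^ 2 ≤ (2 * N) ^ 2 := by rw [← sq_abs]; gcongr
    linarith
  have e : (v ^ 2)⁻¹ * (l * ((d + v * x) ^ 2 - d ^ 2)) - 2 * mu * (x * d)
      = 2 * (l / v - mu) * d * x + l / v * v * x ^ 2 := by
    field_simp; ring
  rw [e]
  refine (abs_add_le _ _).trans ?_
  rw [abs_mul, abs_mul, abs_mul, abs_mul, abs_mul (l / v), abs_two, abs_of_nonneg (sq_nonneg x)]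
  calc 2 * |l / v - mu| * |d| * |x| + |l / v| * |v| * x ^ 2
      ≤ 2 * |l / v - mu| * |d| * (2 * (1 + N ^ 2)) + |l / v| * |v| * (4 * (1 + N ^ 2)) := by
        gcongr; linarith
    _ = _ := by ring

/-- A bound, relative to `1 + ‖u‖ ^ 2`, for the distance between the rescaled penalty with tuning
parameters `l` and `m` and its limit. A coordinate with `β j = 0` contributes `2 * |v| / 0 = 0` to
the second part of the first sum, as it should: `|v * u j|` needs no linearization. -/
noncomputable def penaltyError (β : EuclideanSpace ℝ (Fin p)) (l m v lam mu : ℝ) : ℝ :=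
  ∑ j, (|l / v - lam| + |l / v| * (2 * |v| / |β j|))
    + ∑ k : Fin (p - 1), (4 * |m / v - mu| * |β (succ k) - β (prev k)| + 4 * |m / v| * |v|)

lemma abs_localPenalty_sub_limitPenalty_le (β u : EuclideanSpace ℝ (Fin p)) {l m v lam mu : ℝ}
    (hl : 0 ≤ l) (hlam : 0 ≤ lam) (hv : v ≠ 0) :
    |localPenalty l m β v u - limitPenalty β lam mu u|
      ≤ penaltyError β l m v lam mu * (1 + ‖u‖ ^ 2) := by
  have hu : ∀ j, |u j| ≤ ‖u‖ := fun j => PiLp.norm_apply_le u j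
  have e : localPenalty l m β v u - limitPenalty β lam mu u
      = ∑ j, ((v ^ 2)⁻¹ * (l * (|β j + v * u j| - |β j|))
          - lam * (u j * Real.sign (β j) * (if β j ≠ 0 then 1 else 0)
            + |u j| * (if β j = 0 then 1 else 0)))
        + ∑ k : Fin (p - 1), ((v ^ 2)⁻¹ * (m * (((β (succ k) - β (prev k))
            + v * (u (succ k) - u (prev k))) ^ 2 - (β (succ k) - β (prev k)) ^ 2))
          - 2 * mu * ((u (succ k) - u (prev k)) * (β (succ k) - β (prev k)))) := by
    have e1 : ∀ k : Fin (p - 1), (u (succ k) - u (prev k)) * (β (succ k) - β (prev k))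
        * (if β (succ k) ≠ β (prev k) then 1 else 0)
        = (u (succ k) - u (prev k)) * (β (succ k) - β (prev k)) := by
      intro k
      split_ifs with h
      · rw [mul_one]
      · rw [not_not.1 h]; simp
    have e2 : ∀ k : Fin (p - 1), (β (succ k) - β (prev k)) + v * (u (succ k) - u (prev k))
        = (β (succ k) + v * u (succ k)) - (β (prev k) + v * u (prev k)) := fun k => by ring
    simp only [e1, e2, localPenalty, limitPenalty, penalty, Finset.sum_sub_distrib,
      ← Finset.mul_sum, PiLp.add_apply, PiLp.smul_apply, smul_eq_mul]
    ring
  rw [e, penaltyError, add_mul, Finset.sum_mul, Finset.sum_mul]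
  refine (abs_add_le _ _).trans (add_le_add ?_ ?_)
  · exact (Finset.abs_sum_le_sum_abs _ _).trans
      (Finset.sum_le_sum fun j _ => abs_localPenalty_l1_term_le hl hlam hv (hu j))
  · refine (Finset.abs_sum_le_sum_abs _ _).trans
      (Finset.sum_le_sum fun k _ => abs_localPenalty_l2_term_le hv ?_)
    linarith [abs_sub (u (succ k)) (u (prev k)), hu (succ k), hu (prev k)]

lemma tendsto_penaltyError (β : EuclideanSpace ℝ (Fin p)) {l m v : ℕ → ℝ} {lam mu : ℝ}
    (hv : Tendsto v atTop (𝓝 0)) (hl : Tendsto (fun n => l n / v n) atTop (𝓝 lam))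
    (hm : Tendsto (fun n => m n / v n) atTop (𝓝 mu)) :
    Tendsto (fun n => penaltyError β (l n) (m n) (v n) lam mu) atTop (𝓝 0) := by
  have hl0 : Tendsto (fun n => |l n / v n - lam|) atTop (𝓝 0) := by
    simpa using (hl.sub_const lam).abs
  have hm0 : Tendsto (fun n => |m n / v n - mu|) atTop (𝓝 0) := by
    simpa using (hm.sub_const mu).abs
  have hv0 : Tendsto (fun n => |v n|) atTop (𝓝 0) := by simpa using hv.abs
  have h1 : Tendsto (fun n => ∑ j, (|l n / v n - lam| + |l n / v n| * (2 * |v n| / |β j|)))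
      atTop (𝓝 (∑ j : Fin p, (0 + |lam| * (2 * 0 / |β j|)))) :=
    tendsto_finsetSum _ fun j _ => hl0.add (hl.abs.mul ((hv0.const_mul 2).div_const _))
  have h2 : Tendsto (fun n => ∑ k : Fin (p - 1),
      (4 * |m n / v n - mu| * |β (succ k) - β (prev k)| + 4 * |m n / v n| * |v n|))
      atTop (𝓝 (∑ k : Fin (p - 1), (4 * 0 * |β (succ k) - β (prev k)| + 4 * |mu| * 0))) :=
    tendsto_finsetSum _ fun k _ =>
      ((hm0.const_mul 4).mul_const _).add ((hm.abs.const_mul 4).mul hv0)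
  simpa [penaltyError] using h1.add h2

/-- The entrywise `ℓ¹` distance between two matrices. -/
noncomputable def entryDist (A B : Matrix (Fin p) (Fin p) ℝ) : ℝ :=
  ∑ jk : Fin p × Fin p, |A jk.1 jk.2 - B jk.1 jk.2|

lemma abs_dotProduct_mulVec_sub_le (A B : Matrix (Fin p) (Fin p) ℝ)
    (u : EuclideanSpace ℝ (Fin p)) :
    |u.ofLp ⬝ᵥ (A *ᵥ u.ofLp) - u.ofLp ⬝ᵥ (B *ᵥ u.ofLp)| ≤ entryDist A B * ‖u‖ ^ 2 := by
  have hu : ∀ j, |u j| ≤ ‖u‖ := fun j => PiLp.norm_apply_le u j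
  have e : u.ofLp ⬝ᵥ (A *ᵥ u.ofLp) - u.ofLp ⬝ᵥ (B *ᵥ u.ofLp)
      = ∑ jk : Fin p × Fin p, (A jk.1 jk.2 - B jk.1 jk.2) * (u jk.1 * u jk.2) := by
    simp only [Fintype.sum_prod_type, dotProduct, Matrix.mulVec, Finset.mul_sum,
      ← Finset.sum_sub_distrib]
    exact Finset.sum_congr rfl fun j _ => Finset.sum_congr rfl fun k _ => by ring
  rw [e, entryDist, Finset.sum_mul]
  refine (Finset.abs_sum_le_sum_abs _ _).trans (Finset.sum_le_sum fun jk _ => ?_)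
  rw [abs_mul, abs_mul, sq]
  gcongr
  exacts [hu _, hu _]

lemma abs_localCriterion_sub_limitObjective_le {X : Matrix (Fin n) (Fin p) ℝ} {y e : Fin n → ℝ}
    {l m v lam mu : ℝ} {β : EuclideanSpace ℝ (Fin p)} (hn : 0 < n) (hv : v ≠ 0) (hl : 0 ≤ l)
    (hlam : 0 ≤ lam) (hy : ∀ i, y i = (X *ᵥ β.ofLp) i + e i) (C : Matrix (Fin p) (Fin p) ℝ)
    (κ : ℝ) (u : EuclideanSpace ℝ (Fin p)) :
    |localCriterion X y l m β v u - limitObjective C β lam mu κ (score X e) u|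
      ≤ (2 * |(Real.sqrt n * v)⁻¹ - κ| * ‖score X e‖ + entryDist (gram X) C
        + penaltyError β l m v lam mu) * (1 + ‖u‖ ^ 2) := by
  rw [localCriterion_eq hn hv hy, limitObjective_eq]
  set s := score X e
  have h1 : |u.ofLp ⬝ᵥ s.ofLp| ≤ ‖s‖ * ‖u‖ := by
    have := abs_real_inner_le_norm s u
    rw [EuclideanSpace.inner_eq_star_dotProduct] at this
    simpa using this
  have h2 := abs_dotProduct_mulVec_sub_le (gram X) C u
  have h3 := abs_localPenalty_sub_limitPenalty_le (m := m) (mu := mu) β u hl hlam hv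
  have h4 : ‖u‖ ≤ 1 + ‖u‖ ^ 2 := by nlinarith [sq_nonneg (‖u‖ - 1)]
  have h5 : ‖u‖ ^ 2 ≤ 1 + ‖u‖ ^ 2 := by linarith
  have h6 : |-2 * ((Real.sqrt n * v)⁻¹ - κ) * (u.ofLp ⬝ᵥ s.ofLp)|
      ≤ 2 * |(Real.sqrt n * v)⁻¹ - κ| * ‖s‖ * (1 + ‖u‖ ^ 2) := by
    rw [abs_mul, abs_mul, abs_neg, abs_two, mul_assoc _ ‖s‖]
    gcongr
    exact h1.trans (by gcongr)
  have hE : 0 ≤ entryDist (gram X) C := Finset.sum_nonneg fun _ _ => abs_nonneg _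
  calc _ = |-2 * ((Real.sqrt n * v)⁻¹ - κ) * (u.ofLp ⬝ᵥ s.ofLp)
        + (u.ofLp ⬝ᵥ (gram X *ᵥ u.ofLp) - u.ofLp ⬝ᵥ (C *ᵥ u.ofLp))
        + (localPenalty l m β v u - limitPenalty β lam mu u)| := by congr 1; ring
    _ ≤ _ := (abs_add_le _ _).trans (add_le_add (abs_add_le _ _) le_rfl)
    _ ≤ 2 * |(Real.sqrt n * v)⁻¹ - κ| * ‖s‖ * (1 + ‖u‖ ^ 2)
        + entryDist (gram X) C * (1 + ‖u‖ ^ 2)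
        + penaltyError β l m v lam mu * (1 + ‖u‖ ^ 2) := by
        gcongr
        exact h2.trans (by gcongr)
    _ = _ := by ring

end SLasso

/-! ### Convergence in probability -/

section InMeasure

variable {Ω : Type*} [MeasurableSpace Ω] {P : Measure Ω}

lemma MeasureTheory.TendstoInMeasure.finset_sum_abs_sub {ι : Type*} [Fintype ι]
    {f : ι → ℕ → Ω → ℝ} {g : ι → Ω → ℝ} (h : ∀ i, TendstoInMeasure P (f i) atTop (g i)) :
    TendstoInMeasure P (fun n ω => ∑ i, |f i n ω - g i ω|) atTop (fun _ => 0) := by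
  rw [tendstoInMeasure_iff_norm]
  intro ε hε
  set N : ℝ := Fintype.card ι + 1 with hN
  have hN0 : 0 < N := by positivity
  have hsum : Tendsto (fun n => ∑ i, P {ω | ε / N ≤ ‖f i n ω - g i ω‖}) atTop (𝓝 0) := by
    simpa using tendsto_finsetSum Finset.univ
      fun i _ => tendstoInMeasure_iff_norm.1 (h i) (ε / N) (by positivity)
  refine tendsto_of_tendsto_of_tendsto_of_le_of_le tendsto_const_nhds hsum
    (fun _ => zero_le) fun n => ?_
  refine le_trans (measure_mono fun ω hω => ?_) (measure_iUnion_fintype_le P _)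
  by_contra hcon
  simp only [Set.mem_iUnion, Set.mem_ofPred_eq, not_exists, not_le, Real.norm_eq_abs] at hcon hω
  rw [sub_zero, abs_of_nonneg (Finset.sum_nonneg fun _ _ => abs_nonneg _)] at hω
  have h1 : ∑ i, |f i n ω - g i ω| ≤ ∑ _i : ι, ε / N :=
    Finset.sum_le_sum fun i _ => (hcon i).le
  rw [Finset.sum_const, nsmul_eq_mul, Finset.card_univ] at h1
  have h2 : (Fintype.card ι : ℝ) * (ε / N) < ε := by
    rw [mul_div_assoc', div_lt_iff₀ hN0]; linarith
  linarith

/-- Bounded convergence: convergence in probability to a constant passes through the integral of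
a continuous function that is bounded along the sequence. -/
lemma MeasureTheory.TendstoInMeasure.tendsto_integral_comp_const [IsProbabilityMeasure P]
    {f : ℕ → Ω → ℝ} {c M : ℝ} {φ : ℝ → ℂ} (h : TendstoInMeasure P f atTop (fun _ => c))
    (hf : ∀ n, AEMeasurable (f n) P) (hφ : Continuous φ) (hM : ∀ n ω, ‖φ (f n ω)‖ ≤ M) :
    Tendsto (fun n => ∫ ω, φ (f n ω) ∂P) atTop (𝓝 (φ c)) := by
  refine tendsto_of_subseq_tendsto fun ns hns => ?_
  obtain ⟨ms, -, hms⟩ := (h.comp hns).exists_seq_tendsto_ae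
  refine ⟨ms, ?_⟩
  have h1 := tendsto_integral_of_dominated_convergence (μ := P)
    (F := fun n ω => φ (f (ns (ms n)) ω)) (f := fun _ => φ c) (fun _ => M)
    (fun n => (hφ.measurable.comp_aemeasurable (hf _)).aestronglyMeasurable)
    (integrable_const _) (fun n => ae_of_all _ fun ω => hM _ ω)
    (by filter_upwards [hms] with ω hω using (hφ.tendsto c).comp hω)
  simpa using h1

end InMeasure

/-! ### Asymptotic normality of the score -/

namespace SLasso

variable {p : ℕ} {Ω : Type*} [MeasurableSpace Ω] {P : Measure Ω}

lemma tendstoInMeasure_entryDist_gram {X : (n : ℕ) → Ω → Matrix (Fin n) (Fin p) ℝ}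
    {C : Matrix (Fin p) (Fin p) ℝ}
    (hgram : ∀ j k, TendstoInMeasure P (fun n ω => gram (X n ω) j k) atTop (fun _ => C j k)) :
    TendstoInMeasure P (fun n ω => entryDist (gram (X n ω)) C) atTop (fun _ => 0) :=
  TendstoInMeasure.finset_sum_abs_sub (ι := Fin p × Fin p)
    (f := fun jk n ω => gram (X n ω) jk.1 jk.2) (g := fun jk _ => C jk.1 jk.2)
    fun jk => hgram jk.1 jk.2

section FixedSampleSize

variable {n : ℕ} {X : Ω → Matrix (Fin n) (Fin p) ℝ} {ε : Fin n → Ω → ℝ}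

lemma aemeasurable_gram (hX : ∀ i j, AEMeasurable (fun ω => X ω i j) P) (j k : Fin p) :
    AEMeasurable (fun ω => gram (X ω) j k) P := by
  simp only [gram, Matrix.smul_apply, Matrix.mul_apply, Matrix.transpose_apply, smul_eq_mul]
  exact (Finset.aemeasurable_fun_sum _ fun i _ => (hX i j).mul (hX i k)).const_mul _

lemma aemeasurable_score (hX : ∀ i j, AEMeasurable (fun ω => X ω i j) P)
    (hε : ∀ i, AEMeasurable (ε i) P) :
    AEMeasurable (fun ω => score (X ω) (fun i => ε i ω)) P := by
  refine (PiLp.continuous_toLp 2 (fun _ : Fin p => ℝ)).measurable.comp_aemeasurable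
    (aemeasurable_pi_lambda _ fun j => ?_)
  simp only [Pi.smul_apply, smul_eq_mul, Matrix.vecMul, dotProduct]
  exact (Finset.aemeasurable_fun_sum _ fun i _ => (hε i).mul (hX i j)).const_mul _

/-- The characteristic function of the score. Conditionally on the design the score is Gaussian
with covariance `σ² C_n`; integrating out the noise first turns this into an expectation over the
design alone. -/
lemma charFun_map_score [IsProbabilityMeasure P] {σ : NNReal}
    (hX : ∀ i j, AEMeasurable (fun ω => X ω i j) P)
    (hε_law : ∀ i, HasLaw (ε i) (gaussianReal 0 (σ ^ 2)) P) (hε_indep : iIndepFun ε P)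
    (hXε : IndepFun (fun ω i j => X ω i j) (fun ω i => ε i ω) P) (t : EuclideanSpace ℝ (Fin p)) :
    charFun (P.map fun ω => score (X ω) (fun i => ε i ω)) t
      = ∫ ω, Complex.exp (-((σ : ℝ) ^ 2 / 2 * (t.ofLp ⬝ᵥ (gram (X ω) *ᵥ t.ofLp)) : ℝ)) ∂P := by
  have hε : ∀ i, AEMeasurable (ε i) P := fun i => (hε_law i).aemeasurable
  have hX' : AEMeasurable (fun ω i j => X ω i j) P :=
    aemeasurable_pi_lambda _ fun i => aemeasurable_pi_lambda _ fun j => hX i j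
  have hε' : AEMeasurable (fun ω i => ε i ω) P := aemeasurable_pi_lambda _ hε
  have hlaw : P.map (fun ω i => ε i ω)
      = Measure.pi fun _ : Fin n => gaussianReal 0 (σ ^ 2) := by
    rw [(iIndepFun_iff_map_fun_eq_pi_map hε).1 hε_indep]
    simp only [(hε_law _).map_eq]
  have hjoint := (indepFun_iff_map_prod_eq_prod_map_map hX' hε').1 hXε
  rw [hlaw] at hjoint
  have : IsProbabilityMeasure (P.map fun ω i j => X ω i j) :=
    Measure.isProbabilityMeasure_map hX'
  -- the linear form of the noise given by the design `x`
  let c : (Fin n → Fin p → ℝ) → Fin n → ℝ := fun x i => (Real.sqrt n)⁻¹ * ∑ j, x i j * t j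
  let F : (Fin n → Fin p → ℝ) × (Fin n → ℝ) → ℂ := fun z =>
    Complex.exp (((∑ i, c z.1 i * z.2 i : ℝ) : ℂ) * Complex.I)
  have hFc : Continuous F := by fun_prop
  have hFint : Integrable F ((P.map fun ω i j => X ω i j).prod
      (Measure.pi fun _ : Fin n => gaussianReal 0 (σ ^ 2))) :=
    Integrable.of_bound hFc.aestronglyMeasurable 1
      (ae_of_all _ fun z => (Complex.norm_exp_ofReal_mul_I _).le)
  have hinner : ∀ x, ∫ e, F (x, e) ∂(Measure.pi fun _ : Fin n => gaussianReal 0 (σ ^ 2))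
      = Complex.exp (-((σ : ℝ) ^ 2 / 2 * ∑ i, c x i ^ 2 : ℝ)) := by
    intro x
    have e1 : ∀ e, F (x, e) = ∏ i, Complex.exp ((c x i * e i : ℝ) * Complex.I) := by
      intro e
      simp only [F]
      rw [← Complex.exp_sum, Complex.ofReal_sum, Finset.sum_mul]
    simp only [e1]
    rw [integral_fintype_prod_eq_prod (𝕜 := ℂ)
      (fun i (r : ℝ) => Complex.exp ((c x i * r : ℝ) * Complex.I))]
    have e2 : ∀ i, ∫ r : ℝ, Complex.exp ((c x i * r : ℝ) * Complex.I) ∂(gaussianReal 0 (σ ^ 2))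
        = Complex.exp (-((σ : ℝ) ^ 2 / 2 * c x i ^ 2 : ℝ)) := by
      intro i
      have h := charFun_gaussianReal (μ := 0) (v := σ ^ 2) (c x i)
      rw [charFun_apply_real] at h
      simp only [Complex.ofReal_mul]
      rw [h]
      congr 1
      push_cast
      ring
    simp only [e2]
    rw [← Complex.exp_sum]
    congr 1
    push_cast
    rw [Finset.mul_sum, Finset.sum_neg_distrib]
  have hc : ∀ ω i, c (fun i j => X ω i j) i = (Real.sqrt n)⁻¹ * (X ω *ᵥ t.ofLp) i :=
    fun ω i => rfl
  have hF : ∀ ω, Complex.exp (inner ℝ (score (X ω) (fun i => ε i ω)) t * Complex.I)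
      = F (fun i j => X ω i j, fun i => ε i ω) := by
    intro ω
    simp only [F, hc]
    congr 3
    rw [EuclideanSpace.inner_eq_star_dotProduct]
    simp only [star_trivial]
    rw [dotProduct_score, Finset.mul_sum]
    exact Finset.sum_congr rfl fun i _ => by ring
  rw [charFun_apply, integral_map (aemeasurable_score hX hε)
    (by fun_prop)]
  simp only [hF]
  rw [← integral_map (f := F) (hX'.prodMk hε') hFc.aestronglyMeasurable, hjoint,
    integral_prod _ hFint]
  simp only [hinner]
  rw [integral_map hX' (by fun_prop)]
  refine integral_congr_ae (ae_of_all _ fun ω => ?_)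
  simp only [hc, dotProduct_gram, mul_pow, inv_pow, Real.sq_sqrt n.cast_nonneg, Finset.mul_sum]

end FixedSampleSize

variable [IsProbabilityMeasure P] {σ : NNReal}
  {X : (n : ℕ) → Ω → Matrix (Fin n) (Fin p) ℝ} {ε : (n : ℕ) → Fin n → Ω → ℝ}
  {C : Matrix (Fin p) (Fin p) ℝ}

lemma tendsto_charFun_map_score (hX : ∀ n i j, AEMeasurable (fun ω => X n ω i j) P)
    (hε_law : ∀ n i, HasLaw (ε n i) (gaussianReal 0 (σ ^ 2)) P)
    (hε_indep : ∀ n, iIndepFun (ε n) P)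
    (hXε : ∀ n, IndepFun (fun ω i j => X n ω i j) (fun ω i => ε n i ω) P)
    (hC : C.PosDef)
    (hgram : ∀ j k, TendstoInMeasure P (fun n ω => gram (X n ω) j k) atTop (fun _ => C j k))
    (t : EuclideanSpace ℝ (Fin p)) :
    Tendsto (fun n => charFun (P.map fun ω => score (X n ω) (fun i => ε n i ω)) t) atTop
      (𝓝 (charFun (multivariateGaussian 0 (((σ : ℝ) ^ 2) • C)) t)) := by
  have hq : TendstoInMeasure P (fun n ω => t.ofLp ⬝ᵥ (gram (X n ω) *ᵥ t.ofLp)) atTop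
      (fun _ => t.ofLp ⬝ᵥ (C *ᵥ t.ofLp)) := by
    have hD := tendstoInMeasure_iff_norm.1 (tendstoInMeasure_entryDist_gram hgram)
    rw [tendstoInMeasure_iff_norm]
    intro δ hδ
    have hN : 0 < ‖t‖ ^ 2 + 1 := by positivity
    refine tendsto_of_tendsto_of_tendsto_of_le_of_le tendsto_const_nhds
      (hD (δ / (‖t‖ ^ 2 + 1)) (by positivity)) (fun _ => zero_le)
      fun n => measure_mono fun ω hω => ?_
    have h1 := abs_dotProduct_mulVec_sub_le (gram (X n ω)) C t
    have h0 : 0 ≤ entryDist (gram (X n ω)) C := Finset.sum_nonneg fun _ _ => abs_nonneg _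
    simp only [Set.mem_ofPred_eq, Real.norm_eq_abs, sub_zero] at hω ⊢
    rw [abs_of_nonneg h0, div_le_iff₀ hN]
    linarith
  have hmeas : ∀ n, AEMeasurable (fun ω => t.ofLp ⬝ᵥ (gram (X n ω) *ᵥ t.ofLp)) P := by
    intro n
    simp only [dotProduct, Matrix.mulVec]
    exact Finset.aemeasurable_fun_sum _ fun j _ => (Finset.aemeasurable_fun_sum _ fun k _ =>
      (aemeasurable_gram (hX n) j k).mul_const _).const_mul _
  have hS : (((σ : ℝ) ^ 2) • C).PosSemidef := hC.posSemidef.smul (sq_nonneg _)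
  have hlim : charFun (multivariateGaussian 0 (((σ : ℝ) ^ 2) • C)) t
      = Complex.exp (-((σ : ℝ) ^ 2 / 2 * (t.ofLp ⬝ᵥ (C *ᵥ t.ofLp)) : ℝ)) := by
    rw [charFun_multivariateGaussian hS, Matrix.smul_mulVec, dotProduct_smul]
    congr 1
    simp
    ring
  rw [hlim]
  simp only [fun n => charFun_map_score (hX n) (hε_law n) (hε_indep n) (hXε n) t]
  refine hq.tendsto_integral_comp_const (M := 1)
    (φ := fun x => Complex.exp (-((σ : ℝ) ^ 2 / 2 * x : ℝ))) hmeas (by fun_prop) fun n ω => ?_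
  have h0 : 0 ≤ (σ : ℝ) ^ 2 / 2 * (t.ofLp ⬝ᵥ (gram (X n ω) *ᵥ t.ofLp)) := by
    rw [dotProduct_gram]; positivity
  rw [← Complex.ofReal_neg, Complex.norm_exp_ofReal]
  exact Real.exp_le_one_iff.2 (neg_nonpos.2 h0)

/-- Asymptotic normality of the score, by Lévy's continuity theorem. -/
lemma tendstoInDistribution_score {Ω' : Type*} [MeasurableSpace Ω'] {P' : Measure Ω'}
    [IsProbabilityMeasure P'] {W : Ω' → EuclideanSpace ℝ (Fin p)}
    (hX : ∀ n i j, AEMeasurable (fun ω => X n ω i j) P)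
    (hε : ∀ n i, AEMeasurable (ε n i) P)
    (hW : HasLaw W (multivariateGaussian 0 (((σ : ℝ) ^ 2) • C)) P')
    (hchar : ∀ t, Tendsto (fun n => charFun (P.map fun ω => score (X n ω) (fun i => ε n i ω)) t)
      atTop (𝓝 (charFun (multivariateGaussian 0 (((σ : ℝ) ^ 2) • C)) t))) :
    TendstoInDistribution (fun n ω => score (X n ω) (fun i => ε n i ω)) atTop W
      (fun _ => P) P' where
  forall_aemeasurable n := aemeasurable_score (hX n) (hε n)
  aemeasurable_limit := hW.aemeasurable
  tendsto := by
    refine ProbabilityMeasure.tendsto_iff_tendsto_charFun.2 fun t => ?_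
    simpa only [ProbabilityMeasure.coe_mk, hW.map_eq] using hchar t

/-- The score is bounded in probability. -/
lemma exists_measure_norm_score_gt_le (hX : ∀ n i j, AEMeasurable (fun ω => X n ω i j) P)
    (hε : ∀ n i, AEMeasurable (ε n i) P)
    (hchar : ∀ t, Tendsto (fun n => charFun (P.map fun ω => score (X n ω) (fun i => ε n i ω)) t)
      atTop (𝓝 (charFun (multivariateGaussian 0 (((σ : ℝ) ^ 2) • C)) t)))
    {η : ENNReal} (hη : 0 < η) :
    ∃ M : ℝ, ∀ n, P {ω | M < ‖score (X n ω) (fun i => ε n i ω)‖} ≤ η := by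
  have hmeas := fun n => aemeasurable_score (hX n) (hε n)
  have : ∀ n, IsProbabilityMeasure (P.map fun ω => score (X n ω) (fun i => ε n i ω)) :=
    fun n => Measure.isProbabilityMeasure_map (hmeas n)
  have htight := isTightMeasureSet_of_tendsto_charFun (f := charFun _)
    (continuous_charFun.continuousAt) hchar
  obtain ⟨K, hK, hKη⟩ := isTightMeasureSet_iff_exists_isCompact_measure_compl_le.1 htight η hη
  obtain ⟨M, hM⟩ := hK.isBounded.exists_norm_le
  refine ⟨M, fun n => le_trans ?_ (hKη _ ⟨n, rfl⟩)⟩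
  rw [Measure.map_apply_of_aemeasurable (hmeas n) hK.measurableSet.compl]
  exact measure_mono fun ω hω hcon => (hM _ hcon).not_gt hω

end SLasso

/-! ### Comparison of the rescaled estimator with the minimizer of the limiting objective -/

namespace SLasso

/-- If `g w` minimizes the limiting objective with `W` replaced by `w`, the rescaled estimator and
`g` evaluated at the score differ by a quantity that tends to zero in probability. -/
lemma tendstoInMeasure_estimator_sub {p : ℕ} {Ω : Type*} [MeasurableSpace Ω] {P : Measure Ω}
    {β : EuclideanSpace ℝ (Fin p)}
    {X : (n : ℕ) → Ω → Matrix (Fin n) (Fin p) ℝ} {ε : (n : ℕ) → Fin n → Ω → ℝ}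
    {Y : (n : ℕ) → Ω → Fin n → ℝ}
    (hY : ∀ n ω i, Y n ω i = (X n ω *ᵥ β.ofLp) i + ε n i ω)
    {C : Matrix (Fin p) (Fin p) ℝ} {c : ℝ} (hc : 0 < c)
    (hC : ∀ u : EuclideanSpace ℝ (Fin p), c * ‖u‖ ^ 2 ≤ u.ofLp ⬝ᵥ (C *ᵥ u.ofLp))
    (hgram : ∀ j k, TendstoInMeasure P (fun n ω => gram (X n ω) j k) atTop (fun _ => C j k))
    {v lamn mun : ℕ → ℝ} {lam mu κ : ℝ}
    (hv0 : ∀ n, 0 < n → v n ≠ 0) (hv : Tendsto v atTop (𝓝 0)) (hlamn : ∀ n, 0 ≤ lamn n)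
    (hlam : Tendsto (fun n => lamn n / v n) atTop (𝓝 lam)) (hlam0 : 0 ≤ lam)
    (hmu : Tendsto (fun n => mun n / v n) atTop (𝓝 mu))
    (hκ : Tendsto (fun n : ℕ => (Real.sqrt n * v n)⁻¹) atTop (𝓝 κ))
    {βhat : ℕ → Ω → EuclideanSpace ℝ (Fin p)}
    (hβhat : ∀ n, ∀ᵐ ω ∂P, IsSLasso (X n ω) (Y n ω) (lamn n) (mun n) (βhat n ω))
    (htight : ∀ η : ENNReal, 0 < η →
      ∃ M : ℝ, ∀ n, P {ω | M < ‖score (X n ω) (fun i => ε n i ω)‖} ≤ η)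
    {g : EuclideanSpace ℝ (Fin p) → EuclideanSpace ℝ (Fin p)} (hgc : Continuous g)
    (hg : ∀ w, IsMinOn (limitObjective C β lam mu κ w) Set.univ (g w)) :
    TendstoInMeasure P ((fun n ω => (v n)⁻¹ • (βhat n ω - β))
      - fun n ω => g (score (X n ω) (fun i => ε n i ω))) atTop 0 := by
  rw [tendstoInMeasure_iff_norm]
  intro δ hδ
  simp only [Pi.sub_apply, Pi.zero_apply, sub_zero]
  rw [ENNReal.tendsto_nhds_zero]
  intro η hη
  have hη2 : 0 < η / 2 := ENNReal.half_pos hη.ne'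
  obtain ⟨M, hM⟩ := htight (η / 2) hη2
  obtain ⟨G, hG⟩ := ((isCompact_closedBall (0 : EuclideanSpace ℝ (Fin p)) M).image
    hgc).isBounded.exists_norm_le
  -- a relative perturbation of size `τ` moves the minimizer by less than `δ`
  obtain ⟨τ, hτ, hτc, hτδ⟩ : ∃ τ > 0, τ ≤ c / 4 ∧ τ * (2 + 3 * G ^ 2) < c / 2 * δ ^ 2 := by
    have hB : 0 < 2 + 3 * G ^ 2 := by positivity
    have hr : 0 < c / 2 * δ ^ 2 / 2 / (2 + 3 * G ^ 2) := by positivity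
    refine ⟨min (c / 4) (c / 2 * δ ^ 2 / 2 / (2 + 3 * G ^ 2)), lt_min (by positivity) hr,
      min_le_left _ _, ?_⟩
    calc _ ≤ c / 2 * δ ^ 2 / 2 / (2 + 3 * G ^ 2) * (2 + 3 * G ^ 2) := by
          gcongr; exact min_le_right _ _
      _ = c / 2 * δ ^ 2 / 2 := div_mul_cancel₀ _ hB.ne'
      _ < _ := half_lt_self (by positivity)
  have hdet : Tendsto (fun n : ℕ => 2 * |(Real.sqrt n * v n)⁻¹ - κ| * M
      + penaltyError β (lamn n) (mun n) (v n) lam mu) atTop (𝓝 0) := by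
    have h1 : Tendsto (fun n : ℕ => |(Real.sqrt n * v n)⁻¹ - κ|) atTop (𝓝 0) := by
      simpa using (hκ.sub_const κ).abs
    simpa using ((h1.const_mul 2).mul_const M).add (tendsto_penaltyError β hv hlam hmu)
  have hE := tendstoInMeasure_iff_norm.1 (tendstoInMeasure_entryDist_gram hgram) (τ / 2)
    (half_pos hτ)
  filter_upwards [hdet.eventually_lt_const (half_pos hτ), ENNReal.tendsto_nhds_zero.1 hE _ hη2,
    eventually_gt_atTop 0] with n hn1 hn2 hn0
  calc P {ω | δ ≤ ‖(v n)⁻¹ • (βhat n ω - β) - g (score (X n ω) (fun i => ε n i ω))‖}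
      ≤ P ({ω | M < ‖score (X n ω) (fun i => ε n i ω)‖}
          ∪ {ω | τ / 2 ≤ ‖entryDist (gram (X n ω)) C - 0‖}) := by
        refine measure_mono_ae ?_
        filter_upwards [hβhat n] with ω hω hbig
        by_contra hcon
        change ¬ (M < _ ∨ τ / 2 ≤ _) at hcon
        change δ ≤ _ at hbig
        rw [not_or, not_lt, not_le, sub_zero, Real.norm_eq_abs] at hcon
        obtain ⟨hs, hd⟩ := hcon
        have hd' := (le_abs_self _).trans_lt hd
        set s := score (X n ω) (fun i => ε n i ω) with hs_def
        have hgG : ‖g s‖ ≤ G := hG _ ⟨s, by simpa using hs, rfl⟩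
        have hpert : ∀ u, |localCriterion (X n ω) (Y n ω) (lamn n) (mun n) β (v n) u
            - limitObjective C β lam mu κ s u| ≤ τ * (1 + ‖u‖ ^ 2) := by
          intro u
          refine (abs_localCriterion_sub_limitObjective_le hn0 (hv0 n hn0) (hlamn n) hlam0
            (hY n ω) C κ u).trans ?_
          gcongr
          have : 2 * |(Real.sqrt n * v n)⁻¹ - κ| * ‖s‖
              ≤ 2 * |(Real.sqrt n * v n)⁻¹ - κ| * M := by gcongr
          linarith
        have hmin := (strongConvexOn_limitObjective hC β mu κ hlam0 s).sq_dist_isMinOn_le (hg s)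
          (isMinOn_localCriterion hω β (hv0 n hn0)) hpert (by linarith)
        have h1 : τ * (2 + 3 * ‖g s‖ ^ 2) ≤ τ * (2 + 3 * G ^ 2) := by gcongr
        have h2 : δ ^ 2 ≤ ‖(v n)⁻¹ • (βhat n ω - β) - g s‖ ^ 2 := by gcongr
        have h3 := mul_le_mul_of_nonneg_left h2 (half_pos hc).le
        linarith
    _ ≤ η / 2 + η / 2 := (measure_union_le _ _).trans (add_le_add (hM n) hn2)
    _ = η := ENNReal.add_halves η

end SLasso

/-! ### The limit distribution of the estimator -/

theorem mainTheorem1 {p : ℕ} {Ω Ω' : Type*} [MeasurableSpace Ω] [MeasurableSpace Ω']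
    (P : Measure Ω) [IsProbabilityMeasure P] (P' : Measure Ω') [IsProbabilityMeasure P']
    (β : EuclideanSpace ℝ (Fin p)) (σ : NNReal)
    (X : (n : ℕ) → Ω → Matrix (Fin n) (Fin p) ℝ)
    (ε : (n : ℕ) → Fin n → Ω → ℝ)
    (Y : (n : ℕ) → Ω → Fin n → ℝ)
    (hX : ∀ n i j, AEMeasurable (fun ω => X n ω i j) P)
    (hε_law : ∀ n i, HasLaw (ε n i) (gaussianReal 0 (σ ^ 2)) P)
    (hε_indep : ∀ n, iIndepFun (ε n) P)
    (hXε : ∀ n, IndepFun (fun ω i j => X n ω i j) (fun ω i => ε n i ω) P)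
    (hY : ∀ n ω i, Y n ω i = (X n ω *ᵥ β.ofLp) i + ε n i ω)
    (C : Matrix (Fin p) (Fin p) ℝ) (hC : C.PosDef)
    (hgram : ∀ j k, TendstoInMeasure P (fun n ω => SLasso.gram (X n ω) j k) atTop
      (fun _ => C j k))
    (v lamn mun : ℕ → ℝ) (lam mu κ : ℝ)
    (hv0 : ∀ n, 0 < n → v n ≠ 0) (hv : Tendsto v atTop (𝓝 0))
    (hlamn : ∀ n, 0 ≤ lamn n) (hmun : ∀ n, 0 ≤ mun n)
    (hlam : Tendsto (fun n => lamn n / v n) atTop (𝓝 lam)) (hlam0 : 0 ≤ lam)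
    (hmu : Tendsto (fun n => mun n / v n) atTop (𝓝 mu)) (hmu0 : 0 ≤ mu)
    (hκ : Tendsto (fun n : ℕ => (Real.sqrt n * v n)⁻¹) atTop (𝓝 κ)) (hκ0 : 0 ≤ κ)
    (βhat : ℕ → Ω → EuclideanSpace ℝ (Fin p))
    (hβhat_meas : ∀ n, AEMeasurable (βhat n) P)
    (hβhat : ∀ n, ∀ᵐ ω ∂P, SLasso.IsSLasso (X n ω) (Y n ω) (lamn n) (mun n) (βhat n ω))
    (W : Ω' → EuclideanSpace ℝ (Fin p))
    (hW : HasLaw W (multivariateGaussian 0 (((σ : ℝ) ^ 2) • C)) P') :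
    (∀ w, ConvexOn ℝ Set.univ (SLasso.limitObjective C β lam mu κ w) ∧
      ∃! u, IsMinOn (SLasso.limitObjective C β lam mu κ w) Set.univ u) ∧
    ∀ U : Ω' → EuclideanSpace ℝ (Fin p),
      (∀ᵐ ω' ∂P', IsMinOn (SLasso.limitObjective C β lam mu κ (W ω')) Set.univ (U ω')) →
      TendstoInDistribution (fun n ω => (v n)⁻¹ • (βhat n ω - β)) atTop U (fun _ => P) P' := by
  obtain ⟨c, hc, hCc⟩ := SLasso.exists_pos_mul_sq_norm_le hC
  have hsc := SLasso.strongConvexOn_limitObjective hCc β mu κ hlam0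
  have hc2 : 0 < 2 * c := by linarith
  choose g hg using fun w => (hsc w).exists_isMinOn hc2
    (SLasso.continuous_limitObjective C β lam mu κ w)
  refine ⟨fun w => ⟨((hsc w).strictConvexOn hc2).convexOn, g w, hg w,
    fun u hu => (hsc w).eq_of_isMinOn hc2 (hg w) hu⟩, fun U hU => ?_⟩
  have hgc : Continuous g := by
    refine (LipschitzWith.of_dist_le_mul (K := ⟨κ / c, by positivity⟩) fun w w' => ?_).continuous
    rw [dist_eq_norm, dist_eq_norm]
    exact SLasso.dist_isMinOn_limitObjective_le hCc hc hlam0 hκ0 (hg w) (hg w')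
  have hε := fun n i => (hε_law n i).aemeasurable
  have hchar := SLasso.tendsto_charFun_map_score hX hε_law hε_indep hXε hC hgram
  have hlim := (SLasso.tendstoInDistribution_score hX hε hW hchar).continuous_comp hgc
  have hsub := SLasso.tendstoInMeasure_estimator_sub hY hc hCc hgram hv0 hv hlamn hlam hlam0 hmu hκ
    hβhat (fun η hη => SLasso.exists_measure_norm_score_gt_le hX hε hchar hη) hgc hg
  have hgU : g ∘ W =ᵐ[P'] U := by
    filter_upwards [hU] with ω' hω'
    exact (hsc (W ω')).eq_of_isMinOn hc2 hω' (hg (W ω'))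
  exact (tendstoInDistribution_of_tendstoInMeasure_sub _ _ hlim hsub
    fun n => ((hβhat_meas n).sub_const β).const_smul (v n)⁻¹).congr (fun n => ae_eq_rfl) hgU
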